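/- All matrices are complex and sizes may be $0$. For matrices $B\in\mathbb C^{m\times d}$ and $A\in\mathbb C^{m\times n}$, let $[B\,|\,A]$ denote the data of the total least squares problem $AX\approx B$. Two such problems $[B\,|\,A]$ and $[B'\,|\,A']$ of the same sizes are \emph{unitarily equivalent} if $P^*BR=B'$ and $P^*AQ=A'$ for some unitary matrices $P,Q,R$. Consider all unitary $P,Q,R$ with $$P^*[BR\,|\,AQ]=\left[\begin{array}{cc|cc}B_1&0&A_{11}&0\\0&0&0&A_{22}\end{array}\right].$$ $[B_1\,|\,A_{11}]$ is a \emph{core problem} of $[B\,|\,A]$ if it arises in this way with $B_1,A_{11}$ of minimal dimensions and $A_{22}$ of maximal dimensions among all such transformations; a \emph{core problem} is a core problem of some $[B\,|\,A]$. A \emph{reduced structure} of $[B_1\,|\,A_{11}]$ is an ordered family of subproblems (components) $[B_1^{(t)}\,|\,A_{11}^{(t)}]$, $t=1,\dots,g$, each with at least one row and at least one column in $B_1^{(t)}$ (while $A_{11}^{(t)}$ may have no columns), such that for some unitary $P,Q,R$ $$P^*[B_1R\,|\,A_{11}Q]=\bigl[\operatorname{diag}(B_1^{(1)},\dots,B_1^{(g)})\,\big|\,\operatorname{diag}(A_{11}^{(1)},\dots,A_{11}^{(g)})\bigr].$$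 A core problem is \emph{reducible} if it has a reduced structure with $g\ge 2$, and \emph{irreducible} otherwise. A reduced structure is \emph{irreducible} if each of its components is an irreducible core problem. Two reduced structures are \emph{unitarily equivalent} if they have the same number $g$ of components and, for each $t=1,\dots,g$, their $t$-th components are unitarily equivalent. \textbf{Statement.} Every core problem over $\mathbb C$ has, up to unitary equivalence, only finitely many irreducible reduced structures. -/

import Mathlib

open scoped Matrix

/-- The data `[B | A]` of a total least squares problem `A X ≈ B` over `ℂ`:
`A` is `m × n` and `B` is `m × d` (any of the sizes may be `0`). -/
structure TLSProblem where
  m : ℕ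
  n : ℕ
  d : ℕ
  B : Matrix (Fin m) (Fin d) ℂ
  A : Matrix (Fin m) (Fin n) ℂ

/-- Unitarity of a complex matrix, whose rows and columns may carry different labels (two such
finite label sets then have the same cardinality). The column labels are used only to display the
block partition of the transformed matrices. -/
def IsUnitaryMatrix {ι κ : Type} [Fintype ι] [Fintype κ] [DecidableEq ι] [DecidableEq κ]
    (P : Matrix ι κ ℂ) : Prop :=
  Pᴴ * P = 1 ∧ P * Pᴴ = 1

namespace TLSProblem

/-- `[B | A]` and `[B' | A']` are unitarily equivalent: `P* [B R | A Q] = [B' | A']` for some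
unitary matrices `P`, `Q`, `R`. -/
def UnitarilyEquivalent (T T' : TLSProblem) : Prop :=
  ∃ (P : Matrix (Fin T.m) (Fin T'.m) ℂ) (Q : Matrix (Fin T.n) (Fin T'.n) ℂ)
    (R : Matrix (Fin T.d) (Fin T'.d) ℂ),
    IsUnitaryMatrix P ∧ IsUnitaryMatrix Q ∧ IsUnitaryMatrix R ∧
    Pᴴ * T.B * R = T'.B ∧ Pᴴ * T.A * Q = T'.A

/-- With `C = [B₁ | A₁₁]`, some unitary `P`, `Q`, `R` transform `T = [B | A]` into
`P* [B R | A Q] = [B₁ 0 | A₁₁ 0 ; 0 0 | 0 A₂₂]`, with `A₂₂` of size `p × q`. -/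
def ReducesTo (T C : TLSProblem) (p q : ℕ) : Prop :=
  ∃ (e : ℕ) (A₂₂ : Matrix (Fin p) (Fin q) ℂ)
    (P : Matrix (Fin T.m) (Fin C.m ⊕ Fin p) ℂ) (Q : Matrix (Fin T.n) (Fin C.n ⊕ Fin q) ℂ)
    (R : Matrix (Fin T.d) (Fin C.d ⊕ Fin e) ℂ),
    IsUnitaryMatrix P ∧ IsUnitaryMatrix Q ∧ IsUnitaryMatrix R ∧
    Pᴴ * T.B * R = Matrix.fromBlocks C.B 0 0 0 ∧
    Pᴴ * T.A * Q = Matrix.fromBlocks C.A 0 0 A₂₂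

/-- `C = [B₁ | A₁₁]` is a core problem of `T = [B | A]`: among all unitary transformations to the
block form of `ReducesTo`, the block `[B₁ | A₁₁]` has minimal dimensions and the block `A₂₂` has
maximal dimensions. -/
def IsCoreProblemOf (C T : TLSProblem) : Prop :=
  ∃ p q : ℕ, T.ReducesTo C p q ∧
    ∀ (C' : TLSProblem) (p' q' : ℕ), T.ReducesTo C' p' q' →
      C.m ≤ C'.m ∧ C.n ≤ C'.n ∧ C.d ≤ C'.d ∧ p' ≤ p ∧ q' ≤ q

/-- `C` is a core problem, i.e. the core problem of some total least squares problem. -/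
def IsCoreProblem (C : TLSProblem) : Prop :=
  ∃ T : TLSProblem, C.IsCoreProblemOf T

/-- A reduced structure of `C = [B₁ | A₁₁]`: an ordered family of component subproblems
`[B₁⁽ᵗ⁾ | A₁₁⁽ᵗ⁾]`, `t < g`, such that some unitary `P`, `Q`, `R` give
`P* [B₁ R | A₁₁ Q] = [diag (B₁⁽ᵗ⁾) | diag (A₁₁⁽ᵗ⁾)]`. Every component has at least one row and at
least one column in `B₁⁽ᵗ⁾`; the block `A₁₁⁽ᵗ⁾` may have no columns. The case `g = 1` is allowed. -/
structure ReducedStructure (C : TLSProblem) where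
  g : ℕ
  component : Fin g → TLSProblem
  nonempty_component : ∀ t, 0 < (component t).m ∧ 0 < (component t).d
  exists_unitary :
    ∃ (P : Matrix (Fin C.m) (Σ t, Fin (component t).m) ℂ)
      (Q : Matrix (Fin C.n) (Σ t, Fin (component t).n) ℂ)
      (R : Matrix (Fin C.d) (Σ t, Fin (component t).d) ℂ),
      IsUnitaryMatrix P ∧ IsUnitaryMatrix Q ∧ IsUnitaryMatrix R ∧
      Pᴴ * C.B * R = Matrix.blockDiagonal' (fun t => (component t).B) ∧
      Pᴴ * C.A * Q = Matrix.blockDiagonal' (fun t => (component t).A)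

/-- `C` is reducible: it has a reduced structure with at least two components. -/
def IsReducible (C : TLSProblem) : Prop :=
  ∃ S : ReducedStructure C, 2 ≤ S.g

/-- An irreducible core problem is a core problem that is not reducible. -/
def IsIrreducibleCoreProblem (C : TLSProblem) : Prop :=
  C.IsCoreProblem ∧ ¬ C.IsReducible

theorem UnitarilyEquivalent.refl (T : TLSProblem) : T.UnitarilyEquivalent T :=
  ⟨1, 1, 1, by simp [IsUnitaryMatrix], by simp [IsUnitaryMatrix], by simp [IsUnitaryMatrix],
    by simp, by simp⟩

theorem UnitarilyEquivalent.symm {T T' : TLSProblem} (h : T.UnitarilyEquivalent T') :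
    T'.UnitarilyEquivalent T := by
  obtain ⟨P, Q, R, hP, hQ, hR, hB, hA⟩ := h
  refine ⟨Pᴴ, Qᴴ, Rᴴ, ?_, ?_, ?_, ?_, ?_⟩
  · exact ⟨by simpa using hP.2, by simpa using hP.1⟩
  · exact ⟨by simpa using hQ.2, by simpa using hQ.1⟩
  · exact ⟨by simpa using hR.2, by simpa using hR.1⟩
  · calc Pᴴᴴ * T'.B * Rᴴ = (P * Pᴴ) * T.B * (R * Rᴴ) := by
          rw [← hB]; simp only [Matrix.conjTranspose_conjTranspose, Matrix.mul_assoc]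
      _ = T.B := by rw [hP.2, hR.2]; simp
  · calc Pᴴᴴ * T'.A * Qᴴ = (P * Pᴴ) * T.A * (Q * Qᴴ) := by
          rw [← hA]; simp only [Matrix.conjTranspose_conjTranspose, Matrix.mul_assoc]
      _ = T.A := by rw [hP.2, hQ.2]; simp

theorem isUnitaryMatrix_mul {ι κ μ : Type} [Fintype ι] [Fintype κ] [Fintype μ] [DecidableEq ι]
    [DecidableEq κ] [DecidableEq μ] {P : Matrix ι κ ℂ} {P' : Matrix κ μ ℂ}
    (h : IsUnitaryMatrix P) (h' : IsUnitaryMatrix P') : IsUnitaryMatrix (P * P') := by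
  constructor
  · calc (P * P')ᴴ * (P * P') = P'ᴴ * (Pᴴ * P) * P' := by
          simp only [Matrix.conjTranspose_mul, Matrix.mul_assoc]
      _ = 1 := by rw [h.1, Matrix.mul_one, h'.1]
  · calc (P * P') * (P * P')ᴴ = P * (P' * P'ᴴ) * Pᴴ := by
          simp only [Matrix.conjTranspose_mul, Matrix.mul_assoc]
      _ = 1 := by rw [h'.2, Matrix.mul_one, h.2]

theorem UnitarilyEquivalent.trans {T T' T'' : TLSProblem} (h : T.UnitarilyEquivalent T')
    (h' : T'.UnitarilyEquivalent T'') : T.UnitarilyEquivalent T'' := by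
  obtain ⟨P, Q, R, hP, hQ, hR, hB, hA⟩ := h
  obtain ⟨P', Q', R', hP', hQ', hR', hB', hA'⟩ := h'
  refine ⟨P * P', Q * Q', R * R', isUnitaryMatrix_mul hP hP', isUnitaryMatrix_mul hQ hQ',
    isUnitaryMatrix_mul hR hR', ?_, ?_⟩
  · rw [← hB', ← hB]; simp only [Matrix.conjTranspose_mul, Matrix.mul_assoc]
  · rw [← hA', ← hA]; simp only [Matrix.conjTranspose_mul, Matrix.mul_assoc]

namespace ReducedStructure

variable {C : TLSProblem}

/-- A reduced structure is irreducible if all its components are irreducible core problems. -/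
def IsIrreducible (S : ReducedStructure C) : Prop :=
  ∀ t, (S.component t).IsIrreducibleCoreProblem

/-- Two reduced structures are unitarily equivalent if they have the same number of components and
the `t`-th components are unitarily equivalent for every `t`. The order of the components matters:
permuting them is not part of this relation. -/
def Equivalent (S S' : ReducedStructure C) : Prop :=
  ∃ h : S.g = S'.g, ∀ t : Fin S.g,
    (S.component t).UnitarilyEquivalent (S'.component (Fin.cast h t))

theorem Equivalent.refl (S : ReducedStructure C) : S.Equivalent S :=
  ⟨rfl, fun t => UnitarilyEquivalent.refl (S.component t)⟩

theorem Equivalent.symm {S S' : ReducedStructure C} (h : S.Equivalent S') : S'.Equivalent S := by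
  obtain ⟨hg, h⟩ := h
  exact ⟨hg.symm, fun t => (h (Fin.cast hg.symm t)).symm⟩

theorem Equivalent.trans {S S' S'' : ReducedStructure C} (h : S.Equivalent S')
    (h' : S'.Equivalent S'') : S.Equivalent S'' := by
  obtain ⟨hg, h⟩ := h
  obtain ⟨hg', h'⟩ := h'
  exact ⟨hg.trans hg', fun t => (h t).trans (h' (Fin.cast hg t))⟩

end ReducedStructure

/-- The irreducible reduced structures of `C`. -/
def IrreducibleReducedStructure (C : TLSProblem) : Type :=
  {S : ReducedStructure C // S.IsIrreducible}

/-- Unitary equivalence on the irreducible reduced structures of `C`. -/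
def irreducibleReducedStructureSetoid (C : TLSProblem) :
    Setoid (IrreducibleReducedStructure C) where
  r S S' := S.1.Equivalent S'.1
  iseqv := ⟨fun S => ReducedStructure.Equivalent.refl S.1,
    fun h => ReducedStructure.Equivalent.symm h,
    fun h h' => ReducedStructure.Equivalent.trans h h'⟩

end TLSProblem

namespace TLSProblem

open Matrix

/-! Read `[B | A]` as two linear maps into one common row space, considered together with their
adjoints. Irreducible core problems then behave like simple objects. The eigenspaces of a Hermitian
endomorphism split the problem orthogonally. A nonempty summand with zero right-hand side
contradicts minimality of the core, and two summands with nonzero right-hand sides contradict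
irreducibility. So Hermitian endomorphisms are scalar (`IsIrreducibleCoreProblem.eq_smul_one`).
Applied to `X* X`, `Y* Y`, `Z* Z`, this makes every intertwiner with `X ≠ 0` a multiple of a unitary
equivalence.

Fix one irreducible reduced structure `S₀`. The transition matrices from any other structure to `S₀`
are unitary and their blocks are intertwiners, so each component of the other structure is
equivalent to some component of `S₀`. The number of components is at most the number of rows, hence
a class is determined by one of finitely many maps from `Fin g` to `Fin S₀.g`. -/

theorem conj_submatrix {ι κ μ ν ι' κ' : Type} [Fintype ι] [Fintype μ] (P : Matrix ι κ ℂ)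
    (M : Matrix ι μ ℂ) (R : Matrix μ ν ℂ) (e : ι' → κ) (f : κ' → ν) :
    (P.submatrix id e)ᴴ * M * R.submatrix id f = (Pᴴ * M * R).submatrix e f := by
  rw [conjTranspose_submatrix]
  ext i j
  simp [mul_apply]

/-- Since `E` and `a` are Hermitian, the adjoint of `E P = P a` is `a P* = P* E`, so `a` can be
moved past `P*`. -/
theorem mul_conj_of_intertwine {ι κ μ ν : Type} [Fintype ι] [Fintype κ] [Fintype μ]
    [Fintype ν] {E : Matrix ι ι ℂ} {G : Matrix κ κ ℂ} {B : Matrix ι κ ℂ}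
    {P : Matrix ι μ ℂ} {R : Matrix κ ν ℂ} {a : Matrix μ μ ℂ} {b : Matrix ν ν ℂ}
    (hE : E.IsHermitian) (ha : a.IsHermitian) (hEP : E * P = P * a) (hGR : G * R = R * b)
    (h : E * B = B * G) : a * (Pᴴ * B * R) = Pᴴ * B * R * b := by
  have h' : a * Pᴴ = Pᴴ * E := by
    have := congrArg conjTranspose hEP
    rw [conjTranspose_mul, conjTranspose_mul, hE.eq, ha.eq] at this
    exact this.symm
  calc a * (Pᴴ * B * R) = (a * Pᴴ) * B * R := by simp only [Matrix.mul_assoc]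
    _ = Pᴴ * (E * B) * R := by rw [h']; simp only [Matrix.mul_assoc]
    _ = Pᴴ * B * (G * R) := by rw [h]; simp only [Matrix.mul_assoc]
    _ = Pᴴ * B * R * b := by rw [hGR]; simp only [Matrix.mul_assoc]

/-! ### Unitary matrices and eigenspace splittings -/

section Unitary

variable {ι κ μ ν : Type} [Fintype ι] [Fintype κ] [Fintype μ] [Fintype ν] [DecidableEq ι]
  [DecidableEq κ] [DecidableEq μ] [DecidableEq ν]

theorem isUnitaryMatrix_conjTranspose {P : Matrix ι κ ℂ} (h : IsUnitaryMatrix P) :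
    IsUnitaryMatrix Pᴴ :=
  ⟨by simpa using h.2, by simpa using h.1⟩

theorem isUnitaryMatrix_submatrix {P : Matrix ι κ ℂ} (h : IsUnitaryMatrix P) (e : μ ≃ κ) :
    IsUnitaryMatrix (P.submatrix id e) := by
  constructor
  · rw [conjTranspose_submatrix, ← submatrix_mul _ _ e id e Function.bijective_id, h.1,
      submatrix_one_equiv]
  · rw [conjTranspose_submatrix, submatrix_mul_equiv, h.2, submatrix_id_id]

theorem isUnitaryMatrix_fromBlocks {P : Matrix ι κ ℂ} {Q : Matrix μ ν ℂ}
    (hP : IsUnitaryMatrix P) (hQ : IsUnitaryMatrix Q) :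
    IsUnitaryMatrix (fromBlocks P 0 0 Q) := by
  constructor
  · simp [fromBlocks_conjTranspose, fromBlocks_multiply, hP.1, hQ.1]
  · simp [fromBlocks_conjTranspose, fromBlocks_multiply, hP.2, hQ.2]

/-- The diagonal matrix with entries `l` on the first block and `e` on the second. -/
noncomputable def scalarSumDiagonal (ι : Type) [DecidableEq ι] (l : ℝ) (e : μ → ℝ) :
    Matrix (ι ⊕ μ) (ι ⊕ μ) ℂ :=
  diagonal (Sum.elim (fun _ => (l : ℂ)) (fun i => (e i : ℂ)))

/-- A Hermitian matrix is diagonalized by a unitary matrix whose first columns span the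
eigenspace of `l`. -/
theorem exists_unitary_eigenspace_splitting {m : ℕ} {E : Matrix (Fin m) (Fin m) ℂ}
    (hE : E.IsHermitian) (l : ℝ) :
    ∃ (m₁ m₂ : ℕ) (P : Matrix (Fin m) (Fin m₁ ⊕ Fin m₂) ℂ) (e : Fin m₂ → ℝ),
      IsUnitaryMatrix P ∧ (∀ i, e i ≠ l) ∧
      E * P = P * scalarSumDiagonal (Fin m₁) l e ∧
      ((∃ i, hE.eigenvalues i = l) → 0 < m₁) := by
  classical
  let p : Fin m → Prop := fun i => hE.eigenvalues i = l
  let e₁ := Fintype.equivFin {i // p i}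
  let e₂ := Fintype.equivFin {i // ¬ p i}
  let f : Fin (Fintype.card {i // p i}) ⊕ Fin (Fintype.card {i // ¬ p i}) ≃ Fin m :=
    (Equiv.sumCongr e₁.symm e₂.symm).trans (Equiv.sumCompl p)
  let U : Matrix (Fin m) (Fin m) ℂ := hE.eigenvectorUnitary
  have hU : IsUnitaryMatrix U :=
    ⟨Unitary.coe_star_mul_self hE.eigenvectorUnitary,
      Unitary.coe_mul_star_self hE.eigenvectorUnitary⟩
  have hEU : E * U = U * diagonal (fun i => (hE.eigenvalues i : ℂ)) := by
    ext i j
    have := congrFun (hE.mulVec_eigenvectorBasis j) i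
    rw [mul_diagonal]
    simpa [U, mul_apply, mulVec, dotProduct, mul_comm] using this
  refine ⟨_, _, U.submatrix id f, fun i => hE.eigenvalues (e₂.symm i),
    isUnitaryMatrix_submatrix hU f, fun i => (e₂.symm i).2, ?_, ?_⟩
  · ext i j
    have h := congrFun (congrFun hEU i) (f j)
    rw [scalarSumDiagonal, mul_diagonal]
    rw [mul_diagonal] at h
    have h' : (E * U.submatrix id f) i j = (E * U) i (f j) := by simp [mul_apply]
    rw [h', h]
    rcases j with j | j
    · have hj : hE.eigenvalues (f (Sum.inl j)) = l := (e₁.symm j).2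
      simp [hj]
    · simp [f]
  · rintro ⟨i, hi⟩
    exact Fintype.card_pos_iff.2 ⟨⟨i, hi⟩⟩

/-- A matrix intertwining two diagonal matrices, whose entries in the second block all differ from
`l`, is block diagonal. -/
theorem eq_fromBlocks_of_diagonal_comm {e : μ → ℝ} {g : ν → ℝ} {l : ℝ}
    (he : ∀ i, e i ≠ l) (hg : ∀ i, g i ≠ l) {M : Matrix (ι ⊕ μ) (κ ⊕ ν) ℂ}
    (h : scalarSumDiagonal ι l e * M = M * scalarSumDiagonal κ l g) :
    M = fromBlocks M.toBlocks₁₁ 0 0 M.toBlocks₂₂ := by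
  ext i j
  have hij := congrFun (congrFun h i) j
  rw [scalarSumDiagonal, scalarSumDiagonal, mul_diagonal, diagonal_mul] at hij
  rcases i with i | i <;> rcases j with j | j
  · rfl
  · by_contra hne
    simp only [fromBlocks_apply₁₂, Matrix.zero_apply] at hne
    simp only [Sum.elim_inl, Sum.elim_inr] at hij
    rw [mul_comm] at hij
    exact hg j (by exact_mod_cast (mul_left_cancel₀ hne hij).symm)
  · by_contra hne
    simp only [fromBlocks_apply₂₁, Matrix.zero_apply] at hne
    simp only [Sum.elim_inl, Sum.elim_inr] at hij
    rw [mul_comm] at hij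
    exact he i (by exact_mod_cast mul_left_cancel₀ hne hij)
  · rfl

theorem eq_smul_one_of_mul_diagonal {E : Matrix ι ι ℂ} {P : Matrix ι (κ ⊕ μ) ℂ} [IsEmpty μ]
    {l : ℝ} {e : μ → ℝ} (hP : IsUnitaryMatrix P) (h : E * P = P * scalarSumDiagonal κ l e) :
    E = (l : ℂ) • (1 : Matrix ι ι ℂ) := by
  have hd : scalarSumDiagonal κ l e = (l : ℂ) • (1 : Matrix (κ ⊕ μ) (κ ⊕ μ) ℂ) := by
    rw [smul_one_eq_diagonal, scalarSumDiagonal]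
    congr 1
    ext i
    rcases i with i | i
    · rfl
    · exact isEmptyElim i
  rw [hd, Matrix.mul_smul, Matrix.mul_one] at h
  calc E = E * P * Pᴴ := by rw [Matrix.mul_assoc, hP.2, Matrix.mul_one]
    _ = (l : ℂ) • 1 := by rw [h, Matrix.smul_mul, hP.2]

end Unitary

/-! ### Direct sum decompositions of core problems -/

/-- The unitary matrices `P`, `Q`, `R` split `C` into the direct sum of `C₁` and `C₂`. -/
def SplitsAs (C C₁ C₂ : TLSProblem) (P : Matrix (Fin C.m) (Fin C₁.m ⊕ Fin C₂.m) ℂ)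
    (Q : Matrix (Fin C.n) (Fin C₁.n ⊕ Fin C₂.n) ℂ)
    (R : Matrix (Fin C.d) (Fin C₁.d ⊕ Fin C₂.d) ℂ) : Prop :=
  IsUnitaryMatrix P ∧ IsUnitaryMatrix Q ∧ IsUnitaryMatrix R ∧
    Pᴴ * C.B * R = fromBlocks C₁.B 0 0 C₂.B ∧ Pᴴ * C.A * Q = fromBlocks C₁.A 0 0 C₂.A

theorem card_eq_of_isUnitaryMatrix {ι κ : Type} [Fintype ι] [Fintype κ] [DecidableEq ι]
    [DecidableEq κ] {P : Matrix ι κ ℂ} (h : IsUnitaryMatrix P) :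
    Fintype.card ι = Fintype.card κ :=
  Matrix.square_of_invertible P Pᴴ h.2 h.1

/-- Refine the first block of columns of `P₀` by means of `P`. -/
def refineBlocks {k c c₁ c₂ s : ℕ} (P₀ : Matrix (Fin k) (Fin c ⊕ Fin s) ℂ)
    (P : Matrix (Fin c) (Fin c₁ ⊕ Fin c₂) ℂ) : Matrix (Fin k) (Fin c₁ ⊕ Fin (c₂ + s)) ℂ :=
  (P₀ * (fromBlocks P 0 0 1 : Matrix (Fin c ⊕ Fin s) ((Fin c₁ ⊕ Fin c₂) ⊕ Fin s) ℂ)).submatrix id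
    ((Equiv.sumCongr (Equiv.refl _) finSumFinEquiv.symm).trans (Equiv.sumAssoc _ _ _).symm)

theorem isUnitaryMatrix_refineBlocks {k c c₁ c₂ s : ℕ} {P₀ : Matrix (Fin k) (Fin c ⊕ Fin s) ℂ}
    {P : Matrix (Fin c) (Fin c₁ ⊕ Fin c₂) ℂ} (hP₀ : IsUnitaryMatrix P₀) (hP : IsUnitaryMatrix P) :
    IsUnitaryMatrix (refineBlocks P₀ P) :=
  isUnitaryMatrix_submatrix (isUnitaryMatrix_mul hP₀
    (isUnitaryMatrix_fromBlocks hP ⟨by simp, by simp⟩)) _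

theorem refineBlocks_conj {k c c₁ c₂ s l b b₁ b₂ r : ℕ} {P₀ : Matrix (Fin k) (Fin c ⊕ Fin s) ℂ}
    {P : Matrix (Fin c) (Fin c₁ ⊕ Fin c₂) ℂ} {R₀ : Matrix (Fin l) (Fin b ⊕ Fin r) ℂ}
    {R : Matrix (Fin b) (Fin b₁ ⊕ Fin b₂) ℂ} {M : Matrix (Fin k) (Fin l) ℂ}
    {N : Matrix (Fin c) (Fin b) ℂ} {N' : Matrix (Fin s) (Fin r) ℂ}
    {N₁ : Matrix (Fin c₁) (Fin b₁) ℂ} {N₂ : Matrix (Fin c₂) (Fin b₂) ℂ}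
    (hM : P₀ᴴ * M * R₀ = fromBlocks N 0 0 N') (hN : Pᴴ * N * R = fromBlocks N₁ 0 0 N₂) :
    (refineBlocks P₀ P)ᴴ * M * refineBlocks R₀ R = fromBlocks N₁ 0 0
      ((fromBlocks N₂ 0 0 N').submatrix finSumFinEquiv.symm finSumFinEquiv.symm) := by
  let K : Matrix _ _ ℂ := fromBlocks P 0 0 (1 : Matrix (Fin s) (Fin s) ℂ)
  let L : Matrix _ _ ℂ := fromBlocks R 0 0 (1 : Matrix (Fin r) (Fin r) ℂ)
  have h : (P₀ * K)ᴴ * M * (R₀ * L) = fromBlocks (fromBlocks N₁ 0 0 N₂) 0 0 N' := by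
    calc (P₀ * K)ᴴ * M * (R₀ * L) = Kᴴ * (P₀ᴴ * M * R₀) * L := by
          simp only [conjTranspose_mul, Matrix.mul_assoc]
      _ = fromBlocks (fromBlocks N₁ 0 0 N₂) 0 0 N' := by
          rw [hM, fromBlocks_conjTranspose, fromBlocks_multiply, fromBlocks_multiply]
          simp [hN]
  rw [refineBlocks, refineBlocks, conj_submatrix, h]
  ext (i | i) (j | j)
  · rfl
  · cases hj : finSumFinEquiv.symm j <;> simp [hj]
  · cases hi : finSumFinEquiv.symm i <;> simp [hi]
  · cases hi : finSumFinEquiv.symm i <;> cases hj : finSumFinEquiv.symm j <;> simp [hi, hj]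

section Splitting

variable {C C₁ C₂ : TLSProblem} {P : Matrix (Fin C.m) (Fin C₁.m ⊕ Fin C₂.m) ℂ}
  {Q : Matrix (Fin C.n) (Fin C₁.n ⊕ Fin C₂.n) ℂ} {R : Matrix (Fin C.d) (Fin C₁.d ⊕ Fin C₂.d) ℂ}

theorem SplitsAs.swap (h : C.SplitsAs C₁ C₂ P Q R) :
    C.SplitsAs C₂ C₁ (P.submatrix id (Equiv.sumComm _ _)) (Q.submatrix id (Equiv.sumComm _ _))
      (R.submatrix id (Equiv.sumComm _ _)) := by
  obtain ⟨hP, hQ, hR, hB, hA⟩ := h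
  refine ⟨isUnitaryMatrix_submatrix hP _, isUnitaryMatrix_submatrix hQ _,
    isUnitaryMatrix_submatrix hR _, ?_, ?_⟩
  · rw [conj_submatrix, hB]
    ext (i | i) (j | j) <;> rfl
  · rw [conj_submatrix, hA]
    ext (i | i) (j | j) <;> rfl

/-- A summand without right-hand side can be absorbed: its `A` joins the block `A₂₂`, and its
columns of `B` join the zero columns. -/
theorem ReducesTo.of_splitsAs {T : TLSProblem} {p q : ℕ} (hT : T.ReducesTo C p q)
    (h : C.SplitsAs C₁ C₂ P Q R) (hB₂ : C₂.B = 0) :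
    T.ReducesTo C₁ (C₂.m + p) (C₂.n + q) := by
  obtain ⟨e, A₂₂, P₀, Q₀, R₀, hP₀, hQ₀, hR₀, hB₀, hA₀⟩ := hT
  obtain ⟨hP, hQ, hR, hB, hA⟩ := h
  refine ⟨C₂.d + e, (fromBlocks C₂.A 0 0 A₂₂).submatrix finSumFinEquiv.symm finSumFinEquiv.symm,
    refineBlocks P₀ P, refineBlocks Q₀ Q, refineBlocks R₀ R, isUnitaryMatrix_refineBlocks hP₀ hP,
    isUnitaryMatrix_refineBlocks hQ₀ hQ, isUnitaryMatrix_refineBlocks hR₀ hR, ?_,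
    refineBlocks_conj hA₀ hA⟩
  rw [refineBlocks_conj hB₀ hB, hB₂, fromBlocks_zero]
  rfl

/-- By minimality, a core problem has no nonempty direct summand with a vanishing right-hand
side. -/
theorem IsCoreProblem.eq_zero_of_splitsAs (hC : C.IsCoreProblem)
    (h : C.SplitsAs C₁ C₂ P Q R) (hB₂ : C₂.B = 0) : C₂.m = 0 ∧ C₂.n = 0 ∧ C₂.d = 0 := by
  obtain ⟨T, p, q, hT, hmin⟩ := hC
  -- Minimality bounds the sizes of `C` by those of `C₁`, while unitarity makes them the sums of the
  -- sizes of `C₁` and `C₂`.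
  have hle := hmin C₁ _ _ (hT.of_splitsAs h hB₂)
  have h₁ := card_eq_of_isUnitaryMatrix h.1
  have h₂ := card_eq_of_isUnitaryMatrix h.2.1
  have h₃ := card_eq_of_isUnitaryMatrix h.2.2.1
  simp only [Fintype.card_sum, Fintype.card_fin] at h₁ h₂ h₃
  omega

/-- The indices of a family of two blocks. -/
noncomputable def sumEquivSigmaFinTwo (k : Fin 2 → ℕ) :
    Fin (k 0) ⊕ Fin (k 1) ≃ Σ t, Fin (k t) :=
  Equiv.ofBijective (Sum.elim (fun i => ⟨0, i⟩) (fun i => ⟨1, i⟩)) <| by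
    constructor
    · rintro (i | i) (j | j) h <;> simp_all
    · rintro ⟨t, i⟩
      fin_cases t
      · exact ⟨Sum.inl i, rfl⟩
      · exact ⟨Sum.inr i, rfl⟩

@[simp]
theorem sumEquivSigmaFinTwo_inl (k : Fin 2 → ℕ) (i : Fin (k 0)) :
    sumEquivSigmaFinTwo k (Sum.inl i) = ⟨0, i⟩ := rfl

@[simp]
theorem sumEquivSigmaFinTwo_inr (k : Fin 2 → ℕ) (i : Fin (k 1)) :
    sumEquivSigmaFinTwo k (Sum.inr i) = ⟨1, i⟩ := rfl

theorem fromBlocks_submatrix_eq_blockDiagonal' (k l : Fin 2 → ℕ)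
    (M : ∀ t, Matrix (Fin (k t)) (Fin (l t)) ℂ) :
    (fromBlocks (M 0) 0 0 (M 1)).submatrix (sumEquivSigmaFinTwo k).symm
      (sumEquivSigmaFinTwo l).symm = blockDiagonal' M := by
  ext i j
  obtain ⟨i, rfl⟩ := (sumEquivSigmaFinTwo k).surjective i
  obtain ⟨j, rfl⟩ := (sumEquivSigmaFinTwo l).surjective j
  rw [submatrix_apply, Equiv.symm_apply_apply, Equiv.symm_apply_apply]
  rcases i with i | i <;> rcases j with j | j <;>
    simp [blockDiagonal'_apply]

/-- Indexing the two summands by `Fin 2` makes the block sizes agree with those in `blockDiagonal'`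
without casts. -/
theorem SplitsAs.isReducible_family {c : Fin 2 → TLSProblem}
    {P : Matrix (Fin C.m) (Fin (c 0).m ⊕ Fin (c 1).m) ℂ}
    {Q : Matrix (Fin C.n) (Fin (c 0).n ⊕ Fin (c 1).n) ℂ}
    {R : Matrix (Fin C.d) (Fin (c 0).d ⊕ Fin (c 1).d) ℂ} (h : C.SplitsAs (c 0) (c 1) P Q R)
    (hc : ∀ t, 0 < (c t).m ∧ 0 < (c t).d) : C.IsReducible := by
  obtain ⟨hP, hQ, hR, hB, hA⟩ := h
  refine ⟨⟨2, c, hc, P.submatrix id (sumEquivSigmaFinTwo fun t => (c t).m).symm,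
    Q.submatrix id (sumEquivSigmaFinTwo fun t => (c t).n).symm,
    R.submatrix id (sumEquivSigmaFinTwo fun t => (c t).d).symm,
    isUnitaryMatrix_submatrix hP _, isUnitaryMatrix_submatrix hQ _,
    isUnitaryMatrix_submatrix hR _, ?_, ?_⟩, le_rfl⟩
  · rw [conj_submatrix, hB]
    exact fromBlocks_submatrix_eq_blockDiagonal' _ _ fun t => (c t).B
  · rw [conj_submatrix, hA]
    exact fromBlocks_submatrix_eq_blockDiagonal' _ _ fun t => (c t).A

theorem SplitsAs.isReducible (h : C.SplitsAs C₁ C₂ P Q R) (h₁ : 0 < C₁.m ∧ 0 < C₁.d)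
    (h₂ : 0 < C₂.m ∧ 0 < C₂.d) : C.IsReducible :=
  SplitsAs.isReducible_family (c := ![C₁, C₂]) h (Fin.forall_fin_two.2 ⟨h₁, h₂⟩)

end Splitting

/-! ### Schur's lemma -/

/-- Schur's lemma for Hermitian endomorphisms of an irreducible core problem. -/
theorem IsIrreducibleCoreProblem.eq_smul_one {C : TLSProblem} (hC : C.IsIrreducibleCoreProblem)
    (hm : 0 < C.m) {E : Matrix (Fin C.m) (Fin C.m) ℂ} {F : Matrix (Fin C.n) (Fin C.n) ℂ}
    {G : Matrix (Fin C.d) (Fin C.d) ℂ} (hE : E.IsHermitian) (hF : F.IsHermitian)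
    (hG : G.IsHermitian) (hB : E * C.B = C.B * G) (hA : E * C.A = C.A * F) :
    ∃ l : ℝ, E = (l : ℂ) • 1 ∧ F = (l : ℂ) • 1 ∧ G = (l : ℂ) • 1 := by
  -- The same `l` splits `E`, `F` and `G`. Only for `E` is it known beforehand to be an eigenvalue,
  -- so `n₁` and `d₁` might a priori vanish.
  let l : ℝ := hE.eigenvalues ⟨0, hm⟩
  obtain ⟨m₁, m₂, P, e, hP, he, hEP, hm₁⟩ := exists_unitary_eigenspace_splitting hE l
  obtain ⟨n₁, n₂, Q, f, hQ, hf, hFQ, -⟩ := exists_unitary_eigenspace_splitting hF l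
  obtain ⟨d₁, d₂, R, g, hR, hg, hGR, -⟩ := exists_unitary_eigenspace_splitting hG l
  replace hm₁ : 0 < m₁ := hm₁ ⟨_, rfl⟩
  have hstar : (scalarSumDiagonal (Fin m₁) l e).IsHermitian :=
    isHermitian_diagonal_of_self_adjoint _ (by ext (i | i) <;> simp)
  have hMB := eq_fromBlocks_of_diagonal_comm he hg
    (mul_conj_of_intertwine hE hstar hEP hGR hB)
  have hMA := eq_fromBlocks_of_diagonal_comm he hf
    (mul_conj_of_intertwine hE hstar hEP hFQ hA)
  let C₁ : TLSProblem := ⟨m₁, n₁, d₁, (Pᴴ * C.B * R).toBlocks₁₁, (Pᴴ * C.A * Q).toBlocks₁₁⟩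
  let C₂ : TLSProblem := ⟨m₂, n₂, d₂, (Pᴴ * C.B * R).toBlocks₂₂, (Pᴴ * C.A * Q).toBlocks₂₂⟩
  have hsplit : C.SplitsAs C₁ C₂ P Q R := ⟨hP, hQ, hR, hMB, hMA⟩
  have hpos : ∀ D : TLSProblem, D.B ≠ 0 → 0 < D.m ∧ 0 < D.d := by
    intro D hD
    by_contra hcon
    refine hD (Matrix.ext fun i j => (hcon ⟨i.pos, j.pos⟩).elim)
  have hB₁ : C₁.B ≠ 0 := fun h0 => hm₁.ne' (hC.1.eq_zero_of_splitsAs hsplit.swap h0).1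
  have hB₂ : C₂.B = 0 := by
    by_contra h0
    exact hC.2 (hsplit.isReducible (hpos _ hB₁) (hpos _ h0))
  obtain ⟨h₁, h₂, h₃⟩ := hC.1.eq_zero_of_splitsAs hsplit hB₂
  have : IsEmpty (Fin m₂) := by rw [show m₂ = 0 from h₁]; infer_instance
  have : IsEmpty (Fin n₂) := by rw [show n₂ = 0 from h₂]; infer_instance
  have : IsEmpty (Fin d₂) := by rw [show d₂ = 0 from h₃]; infer_instance
  exact ⟨l, eq_smul_one_of_mul_diagonal hP hEP, eq_smul_one_of_mul_diagonal hQ hFQ,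
    eq_smul_one_of_mul_diagonal hR hGR⟩

/-- Triples of matrices intertwining two problems together with their adjoints. -/
structure Intertwines (C D : TLSProblem) (X : Matrix (Fin D.m) (Fin C.m) ℂ)
    (Y : Matrix (Fin D.n) (Fin C.n) ℂ) (Z : Matrix (Fin D.d) (Fin C.d) ℂ) : Prop where
  map_B : X * C.B = D.B * Z
  map_A : X * C.A = D.A * Y
  map_B_adjoint : D.Bᴴ * X = Z * C.Bᴴ
  map_A_adjoint : D.Aᴴ * X = Y * C.Aᴴ

section Schur

variable {C D : TLSProblem} {X : Matrix (Fin D.m) (Fin C.m) ℂ}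
  {Y : Matrix (Fin D.n) (Fin C.n) ℂ} {Z : Matrix (Fin D.d) (Fin C.d) ℂ}

theorem Intertwines.adjoint (h : Intertwines C D X Y Z) : Intertwines D C Xᴴ Yᴴ Zᴴ where
  map_B := by simpa using congrArg conjTranspose h.map_B_adjoint
  map_A := by simpa using congrArg conjTranspose h.map_A_adjoint
  map_B_adjoint := by simpa using congrArg conjTranspose h.map_B
  map_A_adjoint := by simpa using congrArg conjTranspose h.map_A

/-- An intertwiner followed by its adjoint is a Hermitian endomorphism of `C`, so one scalar serves
all three products. -/
theorem Intertwines.exists_adjoint_mul_self (h : Intertwines C D X Y Z)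
    (hC : C.IsIrreducibleCoreProblem) (hm : 0 < C.m) :
    ∃ l : ℝ, Xᴴ * X = (l : ℂ) • 1 ∧ Yᴴ * Y = (l : ℂ) • 1 ∧ Zᴴ * Z = (l : ℂ) • 1 := by
  refine hC.eq_smul_one hm (isHermitian_conjTranspose_mul_self X)
    (isHermitian_conjTranspose_mul_self Y) (isHermitian_conjTranspose_mul_self Z) ?_ ?_
  · rw [Matrix.mul_assoc, h.map_B, ← Matrix.mul_assoc, h.adjoint.map_B, Matrix.mul_assoc]
  · rw [Matrix.mul_assoc, h.map_A, ← Matrix.mul_assoc, h.adjoint.map_A, Matrix.mul_assoc]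

/-- Schur's lemma: a nonzero intertwiner of irreducible core problems is a multiple of a unitary
equivalence. -/
theorem Intertwines.unitarilyEquivalent (h : Intertwines C D X Y Z)
    (hC : C.IsIrreducibleCoreProblem) (hD : D.IsIrreducibleCoreProblem) (hX : X ≠ 0) :
    C.UnitarilyEquivalent D := by
  obtain ⟨i, j, hij⟩ : ∃ i j, X i j ≠ 0 := by
    by_contra! hcon
    exact hX (Matrix.ext hcon)
  obtain ⟨l, hl, hlY, hlZ⟩ := h.exists_adjoint_mul_self hC j.pos
  obtain ⟨l', hl', hlY', hlZ'⟩ := h.adjoint.exists_adjoint_mul_self hD i.pos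
  rw [conjTranspose_conjTranspose] at hl' hlY' hlZ'
  -- Evaluate `X X* X` in two ways and compare at a nonzero entry of `X`.
  have hll' : (l : ℂ) = l' := by
    have h₁ : X * (Xᴴ * X) = (l : ℂ) • X := by rw [hl, Matrix.mul_smul, Matrix.mul_one]
    rw [← Matrix.mul_assoc, hl', Matrix.smul_mul, Matrix.one_mul] at h₁
    have := congrFun (congrFun h₁ i) j
    simp only [Matrix.smul_apply, smul_eq_mul] at this
    exact (mul_right_cancel₀ hij this).symm
  rw [← hll'] at hl' hlY' hlZ'
  -- `l` is the squared norm of column `j` of `X`, which contains the nonzero entry `X i j`.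
  have hpos : 0 < l := by
    have h₁ := congrFun (congrFun hl j) j
    simp only [mul_apply, conjTranspose_apply, Matrix.smul_apply, one_apply_eq, smul_eq_mul,
      mul_one] at h₁
    have h₂ : ∑ x, ‖X x j‖ ^ 2 = l := by
      have : ((∑ x, ‖X x j‖ ^ 2 : ℝ) : ℂ) = l := by
        rw [← h₁]
        push_cast
        refine Finset.sum_congr rfl fun x _ => ?_
        exact (RCLike.conj_mul (X x j)).symm
      exact_mod_cast this
    rw [← h₂]
    exact Finset.sum_pos' (fun _ _ => by positivity)
      ⟨i, Finset.mem_univ _, by positivity⟩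
  obtain ⟨c, hcc, hstar⟩ : ∃ c : ℂ, c * c * l = 1 ∧ star c = c := by
    refine ⟨((Real.sqrt l)⁻¹ : ℝ), ?_, Complex.conj_ofReal _⟩
    have : (Real.sqrt l)⁻¹ * (Real.sqrt l)⁻¹ * l = 1 := by
      have hs : Real.sqrt l ≠ 0 := (Real.sqrt_pos.2 hpos).ne'
      field_simp
      exact (Real.sq_sqrt hpos.le).symm
    exact_mod_cast congrArg (fun x : ℝ => (x : ℂ)) this
  -- The factor `c = 1/√l` normalizes; adjoints appear because an equivalence from `C` to `D` has
  -- its rows labelled by `C`.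
  have key : ∀ {a b : ℕ} (K : Matrix (Fin b) (Fin a) ℂ), Kᴴ * K = (l : ℂ) • 1 →
      K * Kᴴ = (l : ℂ) • 1 → IsUnitaryMatrix (c • Kᴴ) := by
    intro a b K h₁ h₂
    constructor
    · rw [conjTranspose_smul, conjTranspose_conjTranspose, hstar, Matrix.smul_mul,
        Matrix.mul_smul, h₂, smul_smul, smul_smul, hcc, one_smul]
    · rw [conjTranspose_smul, conjTranspose_conjTranspose, hstar, Matrix.smul_mul,
        Matrix.mul_smul, h₁, smul_smul, smul_smul, hcc, one_smul]
  refine ⟨c • Xᴴ, c • Yᴴ, c • Zᴴ, key X hl hl', key Y hlY hlY', key Z hlZ hlZ', ?_, ?_⟩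
  · rw [conjTranspose_smul, conjTranspose_conjTranspose, hstar, Matrix.smul_mul, h.map_B,
      Matrix.smul_mul, Matrix.mul_smul, Matrix.mul_assoc, hlZ', Matrix.mul_smul, Matrix.mul_one,
      smul_smul, smul_smul, hcc, one_smul]
  · rw [conjTranspose_smul, conjTranspose_conjTranspose, hstar, Matrix.smul_mul, h.map_A,
      Matrix.smul_mul, Matrix.mul_smul, Matrix.mul_assoc, hlY', Matrix.mul_smul, Matrix.mul_one,
      smul_smul, smul_smul, hcc, one_smul]

end Schur

/-! ### Blocks of transition matrices -/

section Blocks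

variable {α β : Type} {k l : α → ℕ} {k' l' : β → ℕ}

/-- The block in position `(s, t)`. -/
def block (M : Matrix (Σ s, Fin (k' s)) (Σ t, Fin (k t)) ℂ) (s : β) (t : α) :
    Matrix (Fin (k' s)) (Fin (k t)) ℂ :=
  M.submatrix (fun i => ⟨s, i⟩) (fun j => ⟨t, j⟩)

theorem block_mul_blockDiagonal' [Fintype α] [DecidableEq α]
    (M : Matrix (Σ s, Fin (k' s)) (Σ t, Fin (k t)) ℂ)
    (D : ∀ t, Matrix (Fin (k t)) (Fin (l t)) ℂ) (s : β) (t : α) :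
    block (M * blockDiagonal' D) s t = block M s t * D t := by
  ext i j
  simp only [block, submatrix_apply, mul_apply, Fintype.sum_sigma]
  rw [Finset.sum_eq_single t]
  · simp
  · intro b _ hb
    simp [blockDiagonal'_apply_ne _ _ _ hb]
  · simp

theorem block_blockDiagonal'_mul [Fintype β] [DecidableEq β]
    (M : Matrix (Σ s, Fin (k' s)) (Σ t, Fin (k t)) ℂ)
    (D : ∀ s, Matrix (Fin (l' s)) (Fin (k' s)) ℂ) (s : β) (t : α) :
    block (blockDiagonal' D * M) s t = D s * block M s t := by
  ext i j
  simp only [block, submatrix_apply, mul_apply, Fintype.sum_sigma]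
  rw [Finset.sum_eq_single s]
  · simp
  · intro b _ hb
    simp [blockDiagonal'_apply_ne _ _ _ hb.symm]
  · simp

end Blocks

/-- Two block forms of the same matrix are related by the unitary transition matrices `P'* P` and
`R'* R`. -/
theorem intertwine_of_conj {ι κ μ ν μ' ν' : Type} [Fintype ι] [Fintype κ] [Fintype μ] [Fintype ν]
    [Fintype μ'] [Fintype ν'] [DecidableEq ι] [DecidableEq κ] [DecidableEq μ] [DecidableEq ν]
    [DecidableEq μ'] [DecidableEq ν'] {B : Matrix ι κ ℂ} {P : Matrix ι μ ℂ} {R : Matrix κ ν ℂ}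
    {P' : Matrix ι μ' ℂ} {R' : Matrix κ ν' ℂ} {M : Matrix μ ν ℂ} {M' : Matrix μ' ν' ℂ}
    (hP : IsUnitaryMatrix P) (hR' : IsUnitaryMatrix R')
    (hM : Pᴴ * B * R = M) (hM' : P'ᴴ * B * R' = M') :
    P'ᴴ * P * M = M' * (R'ᴴ * R) := by
  calc P'ᴴ * P * M = P'ᴴ * (P * Pᴴ) * B * R := by
        rw [← hM]; simp only [Matrix.mul_assoc]
    _ = P'ᴴ * B * (R' * R'ᴴ) * R := by
        rw [hP.2, hR'.2, Matrix.mul_one, Matrix.mul_one]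
    _ = M' * (R'ᴴ * R) := by rw [← hM']; simp only [Matrix.mul_assoc]

theorem conj_conjTranspose {ι κ μ ν : Type} [Fintype ι] [Fintype κ] [Fintype μ] [Fintype ν]
    {B : Matrix ι κ ℂ} {P : Matrix ι μ ℂ} {R : Matrix κ ν ℂ} {M : Matrix μ ν ℂ}
    (hM : Pᴴ * B * R = M) : Rᴴ * Bᴴ * P = Mᴴ := by
  rw [← hM]
  simp only [conjTranspose_mul, conjTranspose_conjTranspose, Matrix.mul_assoc]

/-! ### Comparison of two reduced structures -/

namespace ReducedStructure

variable {C : TLSProblem}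

theorem exists_component_unitarilyEquivalent (S S₀ : ReducedStructure C) (hS : S.IsIrreducible)
    (hS₀ : S₀.IsIrreducible) (t : Fin S.g) :
    ∃ s, (S.component t).UnitarilyEquivalent (S₀.component s) := by
  obtain ⟨P, Q, R, hP, hQ, hR, hB, hA⟩ := S.exists_unitary
  obtain ⟨P₀, Q₀, R₀, hP₀, hQ₀, hR₀, hB₀, hA₀⟩ := S₀.exists_unitary
  have hint : ∀ s, Intertwines (S.component t) (S₀.component s)
      (block (k := fun t => (S.component t).m) (k' := fun s => (S₀.component s).m) (P₀ᴴ * P) s t)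
      (block (k := fun t => (S.component t).n) (k' := fun s => (S₀.component s).n) (Q₀ᴴ * Q) s t)
      (block (k := fun t => (S.component t).d) (k' := fun s => (S₀.component s).d)
        (R₀ᴴ * R) s t) := by
    intro s
    constructor
    · have h := intertwine_of_conj hP hR₀ hB hB₀
      rw [← block_mul_blockDiagonal' _ (fun t => (S.component t).B), h,
        block_blockDiagonal'_mul]
    · have h := intertwine_of_conj hP hQ₀ hA hA₀
      rw [← block_mul_blockDiagonal' _ (fun t => (S.component t).A), h,
        block_blockDiagonal'_mul]
    -- The adjoint relations come from the same lemma for `B*`, with the row and column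
    -- transformations exchanged.
    · have h := intertwine_of_conj hR hP₀ (conj_conjTranspose hB) (conj_conjTranspose hB₀)
      rw [blockDiagonal'_conjTranspose, blockDiagonal'_conjTranspose] at h
      rw [← block_mul_blockDiagonal' _ (fun t => (S.component t).Bᴴ), h,
        block_blockDiagonal'_mul]
    · have h := intertwine_of_conj hQ hP₀ (conj_conjTranspose hA) (conj_conjTranspose hA₀)
      rw [blockDiagonal'_conjTranspose, blockDiagonal'_conjTranspose] at h
      rw [← block_mul_blockDiagonal' _ (fun t => (S.component t).Aᴴ), h,
        block_blockDiagonal'_mul]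
  have hU := isUnitaryMatrix_mul (isUnitaryMatrix_conjTranspose hP₀) hP
  -- If all blocks over `t` vanished, the unitary `P₀* P` would have a zero column, as component `t`
  -- has at least one row.
  obtain ⟨s, hs⟩ : ∃ s, block (k := fun t => (S.component t).m)
      (k' := fun s => (S₀.component s).m) (P₀ᴴ * P) s t ≠ 0 := by
    by_contra! hcon
    let j : Fin (S.component t).m := ⟨0, (S.nonempty_component t).1⟩
    have h₁ := congrFun (congrFun hU.1 ⟨t, j⟩) ⟨t, j⟩
    rw [one_apply_eq, mul_apply, Finset.sum_eq_zero] at h₁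
    · exact zero_ne_one h₁
    · rintro ⟨s, i⟩ -
      have : (P₀ᴴ * P) ⟨s, i⟩ ⟨t, j⟩ = 0 := congrFun (congrFun (hcon s) i) j
      rw [this, mul_zero]
  exact ⟨s, (hint s).unitarilyEquivalent (hS t) (hS₀ s) hs⟩

theorem g_le_m (S : ReducedStructure C) : S.g ≤ C.m := by
  obtain ⟨P, _, _, hP, _⟩ := S.exists_unitary
  have h := card_eq_of_isUnitaryMatrix hP
  rw [Fintype.card_sigma] at h
  simp only [Fintype.card_fin] at h
  calc S.g = ∑ _t : Fin S.g, 1 := by simp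
    _ ≤ ∑ t, (S.component t).m := Finset.sum_le_sum fun t _ => (S.nonempty_component t).1
    _ = C.m := h.symm

end ReducedStructure

end TLSProblem

theorem mainTheorem8 (C : TLSProblem) (hC : C.IsCoreProblem) :
    Finite (Quotient (TLSProblem.irreducibleReducedStructureSetoid C)) := by
  rcases isEmpty_or_nonempty (TLSProblem.IrreducibleReducedStructure C) with hemp | ⟨⟨S₀, hS₀⟩⟩
  · have : IsEmpty (Quotient (TLSProblem.irreducibleReducedStructureSetoid C)) :=
      ⟨fun q => q.inductionOn fun S => hemp.elim S⟩
    infer_instance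
  · choose f hf using fun (S : TLSProblem.IrreducibleReducedStructure C) =>
      S.1.exists_component_unitarilyEquivalent S₀ S.2 hS₀
    -- The invariant of a class, read off a representative: the number of components and their
    -- matching with those of `S₀`.
    let F : Quotient (TLSProblem.irreducibleReducedStructureSetoid C) →
        Σ g : Fin (C.m + 1), (Fin g → Fin S₀.g) := fun q =>
      ⟨⟨q.out.1.g, Nat.lt_succ_of_le q.out.1.g_le_m⟩, f q.out⟩
    refine Finite.of_injective F fun q q' h => ?_
    rw [← q.out_eq, ← q'.out_eq]
    apply Quotient.sound
    have key : ∀ S S' : TLSProblem.IrreducibleReducedStructure C,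
        (∃ hg : S.1.g = S'.1.g, ∀ t, f S t = f S' (Fin.cast hg t)) →
        S.1.Equivalent S'.1 := by
      rintro S S' ⟨hg, hfe⟩
      refine ⟨hg, fun t => (hf S t).trans ?_⟩
      rw [hfe t]
      exact (hf S' _).symm
    apply key
    obtain ⟨h₁, h₂⟩ := Sigma.mk.inj_iff.1 h
    have hg : q.out.1.g = q'.out.1.g := congrArg Fin.val h₁
    refine ⟨hg, fun t => ?_⟩
    have aux : ∀ {a b : ℕ} (hab : a = b) (u : Fin a → Fin S₀.g) (v : Fin b → Fin S₀.g),
        HEq u v → ∀ t, u t = v (Fin.cast hab t) := by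
      rintro a _ rfl u v huv t
      rw [eq_of_heq huv]
      rfl
    exact aux hg _ _ h₂ t
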